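/- Let $\mathbb F_q$ be a finite field, $K=\mathbb F_q(x)$, and let $R\subset K$ be the ring of rational functions of degree at most $0$, where $|f/g|=\deg f-\deg g$ and $|0|=-\infty$. Let $n\ge 1$ and let $\mathcal A$ be a $K$-algebra isomorphic to $M_n(K)$, given by its structure constants with respect to a $K$-basis $a_1,\dots,a_{n^2}$. For a ring $S\subset K$, an $S$-order in $\mathcal A$ is a subring containing $1$ that is the $S$-span of a $K$-basis of $\mathcal A$; it is maximal if it is maximal under inclusion among $S$-orders. Let $d_C\ge 1$. Suppose the structure constants are written as fractions of polynomials in $x$ of degree at most $d_C$, and also as fractions of polynomials in $\frac1x$ of degree at most $d_C$. Let $\delta(x)$ be a least common multiple in $\mathbb F_q[x]$ of the denominators of the first representation, and $\delta^*(\frac1x)$ a least common multiple in $\mathbb F_q[\frac1x]$ of those of the second. Let * $\Lambda$ be a maximal $\mathbb F_q[x]$-order containing all $\delta(x)a_i$, and $b_1,\dots,b_{n^2}$ an $\mathbb F_q[x]$-basis of $\Lambda$ that is reduced with respect to the coordinates in the basis $\delta(x)a_1,\dots,\delta(x)a_{n^2}$, that is, $\sum_j|b_j|=|\det B|$, where $|b_j|$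 is the maximum of the degrees of the coordinates of $b_j$ and $B$ is the matrix of these coordinates; * $\Delta'$ be a maximal $\mathbb F_q[\frac1x]$-order containing all $\delta^*(\frac1x)a_i$, and $\Delta=R\Delta'$. (The maximal orders constructed by enlarging the initial lattices $\bigoplus_i\mathbb F_q[x]\,\delta(x)a_i$ and $\bigoplus_i\mathbb F_q[\frac1x]\,\delta^*(\frac1x)a_i$, followed by lattice basis reduction, are of this kind.) Then for every $j$ there is a smallest integer $d_j$ such that $x^{-d_j}b_j\in\Delta$, and $d_{\max}=\max_j d_j$ and $d_{\min}=\min_j d_j$ satisfy $$d_{\max}\le(2n^8+2n^6+2n^2)\,d_C,\qquad d_{\min}\ge-2(2n^8+n^6+2n^2)\,d_C .$$ Moreover $C=\Lambda\cap\Delta$ is finite-dimensional over $\mathbb F_q$, and $$\dim_{\mathbb F_q}C\le n^2\bigl(n^2(2n^8+2n^6+2n^2)d_C+2(2n^8+n^6+2n^2)d_C+1\bigr).$$ -/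

import Mathlib

open Polynomial Module

noncomputable section

namespace MatrixAlgebraOrders

/-- The degree (valuation) of a rational function: `deg f - deg g` for `f / g ≠ 0`,
and `⊥ = -∞` for `0`. -/
def ratDeg {F : Type*} [Field F] (f : RatFunc F) : WithBot ℤ :=
  open Classical in if f = 0 then ⊥ else (f.intDegree : WithBot ℤ)

/-- The degree of a vector of rational functions: the maximum of the degrees of its entries. -/
def vecDeg {F : Type*} [Field F] {ι : Type*} [Fintype ι] (v : ι → RatFunc F) : WithBot ℤ :=
  Finset.univ.sup fun i => ratDeg (v i)

/-- The subring `F[t]` of `F(x)` generated by `F` and an element `t`; it is used for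
`t = x` and for `t = 1/x`. -/
abbrev polyRing {F : Type*} [Field F] (t : RatFunc F) : Subalgebra F (RatFunc F) :=
  Algebra.adjoin F {t}

theorem ratDeg_le_zero {F : Type*} [Field F] (f : RatFunc F) :
    ratDeg f ≤ 0 ↔ f.intDegree ≤ 0 := by
  unfold ratDeg
  split_ifs with h
  · simp [h]
  · exact_mod_cast Iff.rfl

/-- The ring `R` of the rational functions of degree at most zero. -/
def degLEZero (F : Type*) [Field F] : Subalgebra F (RatFunc F) where
  carrier := {f | ratDeg f ≤ 0}
  mul_mem' {f g} hf hg := by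
    simp only [Set.mem_ofPred_eq, ratDeg_le_zero] at *
    by_cases h1 : f = 0
    · simp [h1]
    by_cases h2 : g = 0
    · simp [h2]
    rw [RatFunc.intDegree_mul h1 h2]
    omega
  add_mem' {f g} hf hg := by
    simp only [Set.mem_ofPred_eq, ratDeg_le_zero] at *
    by_cases h2 : g = 0
    · simpa [h2] using hf
    by_cases h3 : f + g = 0
    · simp [h3]
    exact (RatFunc.intDegree_add_le h2 h3).trans (max_le hf hg)
  algebraMap_mem' r := by
    simp only [Set.mem_ofPred_eq, ratDeg_le_zero]
    rw [RatFunc.algebraMap_eq_C, RatFunc.intDegree_C]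

section Orders

variable {F : Type*} [Field F] {A : Type*} [Ring A] [Algebra (RatFunc F) A]

/-- For a subring `S` of `K = F(x)`: a full `S`-lattice in `A` is the `S`-span of
a `K`-basis of `A`. -/
def IsFullLattice (S : Subalgebra F (RatFunc F)) (M : Submodule S A) : Prop :=
  ∃ v : Basis (Fin (finrank (RatFunc F) A)) (RatFunc F) A,
    M = Submodule.span S (Set.range v)

/-- An `S`-order in `A`: a subring containing `1` that is a full `S`-lattice. -/
def IsOrder (S : Subalgebra F (RatFunc F)) (Λ : Subalgebra S A) : Prop :=
  IsFullLattice S (Subalgebra.toSubmodule Λ)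

/-- A maximal `S`-order in `A`: an order that is maximal under inclusion. -/
def IsMaximalOrder (S : Subalgebra F (RatFunc F)) (Λ : Subalgebra S A) : Prop :=
  Maximal (IsOrder S) Λ

/-- The structure constants of `A` with respect to the basis `a` are the fractions
`N i j k (t) / D i j k (t)` of polynomials in `t` of degree at most `d`. -/
structure IsFractionForm {ι : Type*} (t : RatFunc F) (d : ℕ)
    (a : Basis ι (RatFunc F) A) (N D : ι → ι → ι → F[X]) : Prop where
  denom_ne_zero : ∀ i j k, D i j k ≠ 0
  natDegree_num_le : ∀ i j k, (N i j k).natDegree ≤ d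
  natDegree_denom_le : ∀ i j k, (D i j k).natDegree ≤ d
  structureConstant_eq : ∀ i j k,
    a.repr (a i * a j) k = aeval t (N i j k) / aeval t (D i j k)

/-- `δ` is a least common multiple of the polynomials `D i j k`. -/
def IsLCM {ι : Type*} (δ : F[X]) (D : ι → ι → ι → F[X]) : Prop :=
  ∀ c : F[X], δ ∣ c ↔ ∀ i j k, D i j k ∣ c

/-- `a₀` is the basis of the initial almost `F[t]`-order that is obtained from the basis `a`:
write the structure constants of `a` as fractions of polynomials in `t` of degree
at most `d`, and multiply `a` by the least common multiple of the denominators. -/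
def IsInitialBasis {ι : Type*} (t : RatFunc F) (d : ℕ)
    (a a₀ : Basis ι (RatFunc F) A) : Prop :=
  ∃ (N D : ι → ι → ι → F[X]) (δ : F[X]),
    IsFractionForm t d a N D ∧ IsLCM δ D ∧ ∀ i, a₀ i = aeval t δ • a i

/-- The vectors `b` form a reduced basis with respect to the coordinates given by the basis `a₀`:
their orthogonality defect (sum of the degrees of the coordinate vectors minus
the degree of the determinant of the coordinate matrix) is zero. -/
def IsReduced {ι : Type*} [Fintype ι] [DecidableEq ι]
    (a₀ : Basis ι (RatFunc F) A) (b : ι → A) : Prop :=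
  LinearIndependent (RatFunc F) b ∧
    ∑ j, vecDeg (fun i => a₀.repr (b j) i) = ratDeg (a₀.toMatrix b).det

/-- The `R`-module `RΔ` generated by an `F[1/x]`-order `Δ`: the order `Δ` viewed
as an `R`-order. -/
def toR (Δ : Subalgebra (polyRing (RatFunc.X : RatFunc F)⁻¹) A) :
    Submodule (degLEZero F) A :=
  Submodule.span (degLEZero F) (Δ : Set A)

/-- The intersection `C` of an `F[x]`-order and an `F[1/x]`-order viewed as an `R`-order,
as a vector space over `F`. -/
def interC [Algebra F A] [IsScalarTower F (RatFunc F) A]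
    (Λ : Subalgebra (polyRing (RatFunc.X : RatFunc F)) A)
    (Δ : Subalgebra (polyRing (RatFunc.X : RatFunc F)⁻¹) A) : Submodule F A :=
  (Subalgebra.toSubmodule Λ).restrictScalars F ⊓ (toR Δ).restrictScalars F

end Orders

end MatrixAlgebraOrders

end

/-!
Let `N = n ^ 2`, write `|f|` for the degree of a rational function, and identify the algebra with
a matrix algebra, so that it carries the nondegenerate trace form `(x, y) ↦ tr (x y)`; for a basis
`a` let `D a` be the determinant of its Gram matrix (`traceGram`).

Elements of an order over `S` are integral over `S`, hence so are their traces
(`isIntegral_matrix_trace`). Both `F[x]` and the ring `R` of functions of degree at most zero are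
integrally closed, so the traces of `Λ` lie in `F[x]` and those of `Δ` in `R`. By Cramer's rule,
`D a₀` is a common denominator of the coordinates of `Λ` in the basis `a₀`, and `D a₁` plays the
same role for `RΔ`, the basis `a₁` and the ring `R` (`det_traceGram_mul_repr_mem`).

Each of the two bases is a multiple of `a`: `a₀ = δ a` and `a₁ = δ* a`. Consequently
`|D a₀| - |D a₁| = 2 N s` with `s = |δ| - |δ*|`, and `0 ≤ s ≤ 2 N ^ 3 d_C` because a least common
multiple of `N ^ 3` denominators has degree at most `N ^ 3 d_C`. Only this difference enters the
estimates, so no bound on the discriminants themselves is needed.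

Let `β j` be the degree of the `a₀`-coordinates of `b j`. The denominator `D a₀` yields
`β j ≥ -|D a₀|`. Since `b` is reduced, Cramer's rule shows that the `b j`-coordinates of the `a₀ i`
have degree at most `-β j` (`ratDeg_repr_le_of_isReduced`); they are polynomials, and not all of
them vanish, so `β j ≤ 0`. Passing from `a₀`- to `a₁`-coordinates raises degrees by `s`. This gives
`d j ≤ β j + s ≤ s`, next `d j ≥ |D a₁| + s + β j ≥ -(2 N - 1) s`, and in the same way the bound
`(2 N - 1) s` for the degrees of the polynomial `b`-coordinates of an element of `C`
(`exists_degree_bounds`). The bound on the dimension follows by counting coefficients.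
-/

namespace MatrixAlgebraOrders

/-! ### The degree of rational functions -/

section Degree

variable {F : Type*} [Field F]

theorem ratDeg_of_ne_zero {f : RatFunc F} (hf : f ≠ 0) : ratDeg f = (f.intDegree : WithBot ℤ) :=
  if_neg hf

theorem ratDeg_le_coe {f : RatFunc F} {m : ℤ} :
    ratDeg f ≤ (m : WithBot ℤ) ↔ (f ≠ 0 → f.intDegree ≤ m) := by
  unfold ratDeg
  split_ifs with h
  · simp [h]
  · simp [h]

theorem ratDeg_mul_le {f g : RatFunc F} {m k : ℤ} (hf : ratDeg f ≤ (m : WithBot ℤ))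
    (hg : ratDeg g ≤ (k : WithBot ℤ)) : ratDeg (f * g) ≤ ((m + k : ℤ) : WithBot ℤ) := by
  rw [ratDeg_le_coe] at *
  intro h
  rw [RatFunc.intDegree_mul (left_ne_zero_of_mul h) (right_ne_zero_of_mul h)]
  exact add_le_add (hf (left_ne_zero_of_mul h)) (hg (right_ne_zero_of_mul h))

theorem ratDeg_add_le {f g : RatFunc F} {m : ℤ} (hf : ratDeg f ≤ (m : WithBot ℤ))
    (hg : ratDeg g ≤ (m : WithBot ℤ)) : ratDeg (f + g) ≤ (m : WithBot ℤ) := by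
  by_cases hg0 : g = 0
  · simpa [hg0] using hf
  by_cases hf0 : f = 0
  · simpa [hf0] using hg
  rw [ratDeg_le_coe] at *
  intro h
  exact (RatFunc.intDegree_add_le hg0 h).trans (max_le (hf hf0) (hg hg0))

theorem ratDeg_sum_le {ι : Type*} (s : Finset ι) {f : ι → RatFunc F} {m : ℤ}
    (hf : ∀ i ∈ s, ratDeg (f i) ≤ (m : WithBot ℤ)) :
    ratDeg (∑ i ∈ s, f i) ≤ (m : WithBot ℤ) :=
  Finset.sum_induction f (fun g => ratDeg g ≤ (m : WithBot ℤ)) (fun _ _ => ratDeg_add_le)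
    (by simp [ratDeg_le_coe]) hf

theorem ratDeg_prod_le {ι : Type*} (s : Finset ι) {f : ι → RatFunc F} {m : ι → ℤ}
    (hf : ∀ i ∈ s, ratDeg (f i) ≤ (m i : WithBot ℤ)) :
    ratDeg (∏ i ∈ s, f i) ≤ ((∑ i ∈ s, m i : ℤ) : WithBot ℤ) := by
  classical
  induction s using Finset.induction_on with
  | empty => simp [ratDeg_le_zero]
  | insert i s hi ih =>
    rw [Finset.prod_insert hi, Finset.sum_insert hi]
    exact ratDeg_mul_le (hf i (Finset.mem_insert_self i s))
      (ih fun j hj => hf j (Finset.mem_insert_of_mem hj))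

/-- If the `k`-th column of `M` has degree at most `β k`, then `det M` has degree at most
`∑ k, β k`. -/
theorem ratDeg_det_le {ι : Type*} [Fintype ι] [DecidableEq ι] {M : Matrix ι ι (RatFunc F)}
    {β : ι → ℤ} (hM : ∀ i k, ratDeg (M i k) ≤ (β k : WithBot ℤ)) :
    ratDeg M.det ≤ ((∑ k, β k : ℤ) : WithBot ℤ) := by
  rw [Matrix.det_apply']
  refine ratDeg_sum_le _ fun σ _ => ?_
  have hs : ratDeg (((Equiv.Perm.sign σ : ℤˣ) : ℤ) : RatFunc F) ≤ ((0 : ℤ) : WithBot ℤ) := by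
    rcases Int.units_eq_one_or (Equiv.Perm.sign σ) with h | h <;>
      simp [h, ratDeg_le_zero, RatFunc.intDegree_neg]
  simpa using ratDeg_mul_le hs (ratDeg_prod_le Finset.univ fun k _ => hM (σ k) k)

theorem intDegree_pow {f : RatFunc F} (hf : f ≠ 0) (k : ℕ) :
    (f ^ k).intDegree = k * f.intDegree := by
  induction k with
  | zero => simp
  | succ k ih =>
    rw [pow_succ, RatFunc.intDegree_mul (pow_ne_zero k hf) hf, ih]
    push_cast
    ring

theorem intDegree_X_zpow (m : ℤ) : ((RatFunc.X : RatFunc F) ^ m).intDegree = m := by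
  cases m with
  | ofNat k => simp [intDegree_pow RatFunc.X_ne_zero]
  | negSucc k =>
    rw [zpow_negSucc, RatFunc.intDegree_inv, intDegree_pow RatFunc.X_ne_zero, RatFunc.intDegree_X,
      Int.negSucc_eq]
    simp

theorem mem_degLEZero {f : RatFunc F} : f ∈ degLEZero F ↔ f.intDegree ≤ 0 :=
  ratDeg_le_zero f

theorem mem_polyRing_X {f : RatFunc F} :
    f ∈ polyRing (RatFunc.X : RatFunc F) ↔ ∃ p : F[X], algebraMap F[X] (RatFunc F) p = f := by
  rw [polyRing, Algebra.adjoin_singleton_eq_range_aeval]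
  simp

theorem intDegree_nonneg_of_mem_polyRing_X {f : RatFunc F}
    (hf : f ∈ polyRing (RatFunc.X : RatFunc F)) : 0 ≤ f.intDegree := by
  obtain ⟨p, rfl⟩ := mem_polyRing_X.1 hf
  simp [RatFunc.intDegree_polynomial]

theorem polyRing_inv_X_le_degLEZero : polyRing (RatFunc.X : RatFunc F)⁻¹ ≤ degLEZero F := by
  refine Algebra.adjoin_le ?_
  simp [mem_degLEZero, RatFunc.intDegree_inv]

/-- `p(1/x) = x⁻ᵏ q(x)`, where `k` is the degree of `p` and `q` its reverse. -/
theorem algebraMap_reverse_mul_inv_X_pow (p : F[X]) :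
    algebraMap F[X] (RatFunc F) p.reverse * (RatFunc.X : RatFunc F)⁻¹ ^ p.natDegree
      = aeval (RatFunc.X : RatFunc F)⁻¹ p := by
  have hX : (RatFunc.X : RatFunc F) ≠ 0 := RatFunc.X_ne_zero
  let := invertibleOfNonzero (inv_ne_zero hX)
  have h := eval₂_reverse_mul_pow (algebraMap F (RatFunc F)) (RatFunc.X : RatFunc F)⁻¹ p
  rwa [invOf_eq_inv, inv_inv, ← aeval_def, ← aeval_def, RatFunc.aeval_X_left_eq_algebraMap] at h

/-- The degree at infinity of a polynomial `p(1/x)` of degree `k` in `1/x` lies between `-k`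
and `0`. -/
theorem neg_natDegree_le_intDegree_aeval_inv_X {p : F[X]} (hp : p ≠ 0) :
    aeval (RatFunc.X : RatFunc F)⁻¹ p ≠ 0 ∧
      -(p.natDegree : ℤ) ≤ (aeval (RatFunc.X : RatFunc F)⁻¹ p).intDegree ∧
        (aeval (RatFunc.X : RatFunc F)⁻¹ p).intDegree ≤ 0 := by
  have h := algebraMap_reverse_mul_inv_X_pow p
  have hr : algebraMap F[X] (RatFunc F) p.reverse ≠ 0 := by
    simpa [reverse_eq_zero] using hp
  have hX : (RatFunc.X : RatFunc F)⁻¹ ^ p.natDegree ≠ 0 :=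
    pow_ne_zero _ (inv_ne_zero RatFunc.X_ne_zero)
  refine ⟨h ▸ mul_ne_zero hr hX, ?_,
    mem_degLEZero.1 (polyRing_inv_X_le_degLEZero (Polynomial.aeval_mem_adjoin_singleton F _))⟩
  rw [← h, RatFunc.intDegree_mul hr hX, intDegree_pow (inv_ne_zero RatFunc.X_ne_zero),
    RatFunc.intDegree_inv, RatFunc.intDegree_X, RatFunc.intDegree_polynomial]
  omega

end Degree

/-! ### Integrality of traces and integrally closed subrings of `F(x)` -/

section Integral

/-- The trace of a matrix over a field that is integral over a ring `S` is integral over `S`,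
because it is a sum of eigenvalues. -/
theorem isIntegral_matrix_trace {S K ι : Type*} [CommRing S] [Field K] [Algebra S K]
    [Fintype ι] [DecidableEq ι] {M : Matrix ι ι K} (hM : IsIntegral S M) :
    IsIntegral S M.trace := by
  let L := AlgebraicClosure K
  let φ : Matrix ι ι K →ₐ[S] Matrix ι ι L := ((Algebra.ofId K L).restrictScalars S).mapMatrix
  have hφ : IsIntegral S (φ M) := hM.map φ
  have htr : algebraMap K L M.trace = (φ M).trace := by
    exact AddMonoidHom.map_trace (algebraMap K L) M
  rw [← isIntegral_algebraMap_iff (algebraMap K L).injective, htr,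
    Matrix.trace_eq_sum_roots_charpoly]
  refine IsIntegral.multiset_sum fun μ hμ => ?_
  obtain ⟨p, hp, hpM⟩ := hφ
  refine ⟨p, hp, ?_⟩
  have hspec := Matrix.mem_spectrum_of_isRoot_charpoly (isRoot_of_mem_roots hμ)
  have hz : aeval (φ M) (p.map (algebraMap S L)) = 0 := by
    rw [aeval_map_algebraMap]
    exact hpM
  have h := spectrum.subset_polynomial_aeval (φ M) (p.map (algebraMap S L)) ⟨μ, hspec, rfl⟩
  rw [hz] at h
  by_cases hι : Nonempty ι
  · rw [spectrum.zero_eq] at h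
    simpa [eval_map] using h
  · rw [not_nonempty_iff] at hι
    simp at hμ

variable {F : Type*} [Field F]

theorem mem_polyRing_X_of_isIntegral {f : RatFunc F}
    (hf : IsIntegral (polyRing (RatFunc.X : RatFunc F)) f) :
    f ∈ polyRing (RatFunc.X : RatFunc F) := by
  let S := polyRing (RatFunc.X : RatFunc F)
  -- `S` is the image of `F[x]`, so integrality over `S` is integrality over `F[x]`
  let ψ : F[X] →ₐ[F] S := aeval ⟨RatFunc.X, Algebra.self_mem_adjoin_singleton F _⟩
  have hψ : ∀ p, (ψ p : RatFunc F) = algebraMap F[X] (RatFunc F) p := by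
    intro p
    rw [← RatFunc.aeval_X_left_eq_algebraMap, ← Subalgebra.coe_val, ← aeval_algHom_apply, Subalgebra.coe_val]
  let := ψ.toAlgebra
  have : IsScalarTower F[X] S (RatFunc F) := IsScalarTower.of_algebraMap_eq fun p => (hψ p).symm
  have : Algebra.IsIntegral F[X] S := Algebra.isIntegral_of_surjective fun y => by
    obtain ⟨p, hp⟩ := mem_polyRing_X.1 y.2
    exact ⟨p, Subtype.ext ((hψ p).trans hp)⟩
  exact mem_polyRing_X.2 (IsIntegrallyClosed.isIntegral_iff.1 (isIntegral_trans (A := S) f hf))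

theorem inftyValuation_le_one_iff [DecidableEq (RatFunc F)] {f : RatFunc F} :
    RatFunc.inftyValuation F f ≤ 1 ↔ f ∈ degLEZero F := by
  rw [mem_degLEZero, RatFunc.inftyValuation_apply]
  by_cases hf : f = 0
  · simp [hf, RatFunc.inftyValuationDef]
  · rw [RatFunc.inftyValuation_of_nonzero F hf, ← WithZero.exp_zero, WithZero.exp_le_exp]

theorem mem_degLEZero_of_isIntegral {f : RatFunc F} (hf : IsIntegral (degLEZero F) f) :
    f ∈ degLEZero F := by
  classical
  have hv : (RatFunc.inftyValuation F).Integers (degLEZero F) :=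
    ⟨Subtype.val_injective, fun x => inftyValuation_le_one_iff.2 x.2,
      fun {x} hx => ⟨⟨x, inftyValuation_le_one_iff.1 hx⟩, rfl⟩⟩
  exact inftyValuation_le_one_iff.1 (hv.mem_of_integral hf)

end Integral

/-! ### The Gram matrix of the reduced trace form -/

section Gram

variable {F : Type*} [Field F] {A : Type*} [Ring A] [Algebra (RatFunc F) A]
  {m ι : Type*} [Fintype m] [DecidableEq m] [Fintype ι] [DecidableEq ι]

/-- The Gram matrix of the reduced trace form `(x, y) ↦ trace (e (x * y))` at the family `a`,
where `e` identifies `A` with a matrix algebra. -/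
noncomputable def traceGram (e : A ≃ₐ[RatFunc F] Matrix m m (RatFunc F)) (a : ι → A) :
    Matrix ι ι (RatFunc F) :=
  Matrix.of fun i j => (e (a i * a j)).trace

omit [DecidableEq ι] in
theorem repr_vecMul_traceGram (e : A ≃ₐ[RatFunc F] Matrix m m (RatFunc F))
    (a : Basis ι (RatFunc F) A) (x : A) :
    Matrix.vecMul (a.repr x) (traceGram e a) = fun j => (e (x * a j)).trace := by
  ext j
  have hx : x * a j = ∑ i, a.repr x i • (a i * a j) := by
    conv_lhs => rw [← a.sum_repr x, Finset.sum_mul]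
    simp
  rw [hx, map_sum, Matrix.trace_sum]
  exact Finset.sum_congr rfl fun i _ => by rw [map_smul, Matrix.trace_smul]; rfl

/-- The trace form of a matrix algebra is nondegenerate. -/
theorem det_traceGram_ne_zero (e : A ≃ₐ[RatFunc F] Matrix m m (RatFunc F))
    (a : Basis ι (RatFunc F) A) : (traceGram e a).det ≠ 0 := by
  intro h
  obtain ⟨v, hv, hvT⟩ := Matrix.exists_vecMul_eq_zero_iff.2 h
  obtain ⟨x, rfl⟩ : ∃ x : A, ⇑(a.repr x) = v := ⟨a.equivFun.symm v, by
    rw [← a.equivFun_apply, LinearEquiv.apply_symm_apply]⟩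
  rw [repr_vecMul_traceGram] at hvT
  have hx : ∀ y : A, (e (x * y)).trace = 0 := by
    intro y
    rw [← a.sum_repr y, Finset.mul_sum, map_sum, Matrix.trace_sum]
    refine Finset.sum_eq_zero fun j _ => ?_
    rw [mul_smul_comm, map_smul, Matrix.trace_smul, congrFun hvT j, Pi.zero_apply, smul_zero]
  have hex : e x = 0 := Matrix.ext_iff_trace_mul_right.2 fun y => by
    simpa using hx (e.symm y)
  refine hv ?_
  rw [(map_eq_zero_iff e e.injective).1 hex]
  simp

/-- By Cramer's rule, an element whose traces against the basis `a` lie in `S` has coordinates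
in `S` up to the denominator `det (traceGram e a)`. -/
theorem det_traceGram_mul_repr_mem (S : Subalgebra F (RatFunc F))
    (e : A ≃ₐ[RatFunc F] Matrix m m (RatFunc F)) (a : Basis ι (RatFunc F) A)
    (ha : ∀ i j, (e (a i * a j)).trace ∈ S) {x : A} (hx : ∀ j, (e (x * a j)).trace ∈ S) (i : ι) :
    (traceGram e a).det * a.repr x i ∈ S := by
  let T : Matrix ι ι S := Matrix.of fun i j => ⟨(e (a i * a j)).trace, ha i j⟩
  have hT : S.val.toRingHom.mapMatrix T = traceGram e a := rfl
  have h : (traceGram e a).det • ⇑(a.repr x)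
      = Matrix.vecMul (fun j => (e (x * a j)).trace) (traceGram e a).adjugate := by
    rw [← repr_vecMul_traceGram, Matrix.vecMul_vecMul, Matrix.mul_adjugate, Matrix.vecMul_smul,
      Matrix.vecMul_one]
  have hi := congrFun h i
  rw [Pi.smul_apply, smul_eq_mul] at hi
  rw [hi, ← hT, ← RingHom.map_adjugate]
  exact sum_mem fun j _ => mul_mem (hx j) (T.adjugate j i).2

theorem det_traceGram_smul (e : A ≃ₐ[RatFunc F] Matrix m m (RatFunc F)) {a a' : ι → A}
    {c : RatFunc F} (h : ∀ i, a' i = c • a i) :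
    (traceGram e a').det = c ^ (2 * Fintype.card ι) * (traceGram e a).det := by
  have : traceGram e a' = c ^ 2 • traceGram e a := by
    ext i j
    simp [traceGram, h, smul_smul, sq]
  rw [this, Matrix.det_smul, pow_mul]

end Gram

/-! ### Orders and their coordinates -/

section Coordinates

variable {F : Type*} [Field F] {A : Type*} [Ring A] [Algebra (RatFunc F) A]
  {m ι : Type*} [Fintype m] [DecidableEq m] [Fintype ι] [DecidableEq ι]

theorem IsOrder.isIntegral {S : Subalgebra F (RatFunc F)} {Λ : Subalgebra S A}
    (hΛ : IsOrder S Λ) {x : A} (hx : x ∈ Λ) : IsIntegral S x := by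
  obtain ⟨v, hv⟩ := hΛ
  refine IsIntegral.of_mem_of_fg Λ ?_ x hx
  rw [hv]
  exact Submodule.fg_span (Set.finite_range v)

theorem IsOrder.isIntegral_trace {S : Subalgebra F (RatFunc F)} {Λ : Subalgebra S A}
    (hΛ : IsOrder S Λ) (e : A ≃ₐ[RatFunc F] Matrix m m (RatFunc F)) {x : A} (hx : x ∈ Λ) :
    IsIntegral S (e x).trace :=
  isIntegral_matrix_trace
    ((hΛ.isIntegral hx).map ((e : A →ₐ[RatFunc F] Matrix m m (RatFunc F)).restrictScalars S))

theorem det_traceGram_mul_repr_mem_polyRing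
    {Λ : Subalgebra (polyRing (RatFunc.X : RatFunc F)) A}
    (hΛ : IsOrder (polyRing (RatFunc.X : RatFunc F)) Λ)
    (e : A ≃ₐ[RatFunc F] Matrix m m (RatFunc F)) {a : Basis ι (RatFunc F) A}
    (ha : ∀ i, a i ∈ Λ) {x : A} (hx : x ∈ Λ) (i : ι) :
    (traceGram e a).det * a.repr x i ∈ polyRing (RatFunc.X : RatFunc F) :=
  det_traceGram_mul_repr_mem _ e a
    (fun i j => mem_polyRing_X_of_isIntegral (hΛ.isIntegral_trace e (mul_mem (ha i) (ha j))))
    (fun j => mem_polyRing_X_of_isIntegral (hΛ.isIntegral_trace e (mul_mem hx (ha j)))) i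

theorem isIntegral_degLEZero_of_polyRing_inv_X {f : RatFunc F}
    (hf : IsIntegral (polyRing (RatFunc.X : RatFunc F)⁻¹) f) : IsIntegral (degLEZero F) f := by
  obtain ⟨p, hp, hpf⟩ := hf
  refine ⟨p.map (Subalgebra.inclusion polyRing_inv_X_le_degLEZero).toRingHom, hp.map _, ?_⟩
  rw [eval₂_map]
  exact hpf

theorem det_traceGram_mul_repr_mem_degLEZero
    {Δ : Subalgebra (polyRing (RatFunc.X : RatFunc F)⁻¹) A}
    (hΔ : IsOrder (polyRing (RatFunc.X : RatFunc F)⁻¹) Δ)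
    (e : A ≃ₐ[RatFunc F] Matrix m m (RatFunc F)) {a : Basis ι (RatFunc F) A}
    (ha : ∀ i, a i ∈ Δ) {x : A} (hx : x ∈ toR Δ) (i : ι) :
    (traceGram e a).det * a.repr x i ∈ degLEZero F := by
  have htr : ∀ y ∈ Δ, (e y).trace ∈ degLEZero F := fun y hy =>
    mem_degLEZero_of_isIntegral
      (isIntegral_degLEZero_of_polyRing_inv_X (hΔ.isIntegral_trace e hy))
  rw [toR] at hx
  induction hx using Submodule.span_induction with
  | mem x hx =>
    exact det_traceGram_mul_repr_mem _ e a (fun i j => htr _ (mul_mem (ha i) (ha j)))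
      (fun j => htr _ (mul_mem hx (ha j))) i
  | zero => simp
  | add x y _ _ hx hy =>
    rw [map_add, Finsupp.add_apply, mul_add]
    exact add_mem hx hy
  | smul r x _ hx =>
    have : a.repr (r • x) i = (r : RatFunc F) * a.repr x i := by
      rw [Subalgebra.smul_def, map_smul, Finsupp.smul_apply, smul_eq_mul]
    rw [this, mul_left_comm]
    exact mul_mem r.2 hx

omit [DecidableEq ι] in
theorem mem_toR_of_repr_mem {Δ : Subalgebra (polyRing (RatFunc.X : RatFunc F)⁻¹) A}
    {a : Basis ι (RatFunc F) A} (ha : ∀ i, a i ∈ Δ) {x : A}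
    (hx : ∀ i, a.repr x i ∈ degLEZero F) : x ∈ toR Δ := by
  rw [← a.sum_repr x]
  exact sum_mem fun i _ => Submodule.smul_mem (toR Δ) (⟨a.repr x i, hx i⟩ : degLEZero F)
    (Submodule.subset_span (ha i))

end Coordinates

/-! ### Initial bases -/

section InitialBasis

variable {F : Type*} [Field F] {A : Type*} [Ring A] [Algebra (RatFunc F) A]
  {ι : Type*} [Fintype ι]

/-- The least common multiple divides the product of the `card ι ^ 3` denominators, which bounds
its degree. -/
theorem IsInitialBasis.exists_smul {t : RatFunc F} {d : ℕ} {a a₀ : Basis ι (RatFunc F) A}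
    (h : IsInitialBasis t d a a₀) :
    ∃ δ : F[X], δ ≠ 0 ∧ δ.natDegree ≤ Fintype.card ι ^ 3 * d ∧ ∀ i, a₀ i = aeval t δ • a i := by
  obtain ⟨N, D, δ, hND, hδ, ha⟩ := h
  have hdvd : δ ∣ ∏ x : ι × ι × ι, D x.1 x.2.1 x.2.2 :=
    (hδ _).2 fun i j k => Finset.dvd_prod_of_mem (fun x : ι × ι × ι => D x.1 x.2.1 x.2.2)
      (Finset.mem_univ (i, j, k))
  have hprod : ∏ x : ι × ι × ι, D x.1 x.2.1 x.2.2 ≠ 0 :=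
    Finset.prod_ne_zero_iff.2 fun x _ => hND.denom_ne_zero _ _ _
  refine ⟨δ, ne_zero_of_dvd_ne_zero hprod hdvd, ?_, ha⟩
  calc δ.natDegree ≤ (∏ x : ι × ι × ι, D x.1 x.2.1 x.2.2).natDegree :=
        natDegree_le_of_dvd hdvd hprod
    _ ≤ ∑ x : ι × ι × ι, (D x.1 x.2.1 x.2.2).natDegree := natDegree_prod_le _ _
    _ ≤ ∑ _x : ι × ι × ι, d := Finset.sum_le_sum fun x _ => hND.natDegree_denom_le _ _ _
    _ = Fintype.card ι ^ 3 * d := by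
      rw [Finset.sum_const, Finset.card_univ, Fintype.card_prod, Fintype.card_prod, smul_eq_mul]
      ring

theorem repr_eq_mul_repr_of_smul {a a' : Basis ι (RatFunc F) A} {c : RatFunc F}
    (h : ∀ i, a' i = c • a i) (x : A) (i : ι) : a.repr x i = c * a'.repr x i := by
  classical
  conv_lhs => rw [← a'.sum_repr x]
  simp [h, smul_smul, Finsupp.single_apply, mul_comm]

end InitialBasis

/-! ### Coordinates with respect to a reduced basis -/

section Reduced

variable {F : Type*} [Field F] {A : Type*} [Ring A] [Algebra (RatFunc F) A]
  {ι : Type*} [Fintype ι] [DecidableEq ι]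

omit [DecidableEq ι] in
theorem exists_vecDeg_eq {v : ι → RatFunc F} (hv : v ≠ 0) :
    ∃ i, v i ≠ 0 ∧ vecDeg v = ((v i).intDegree : WithBot ℤ) := by
  obtain ⟨i₀, hi₀⟩ := Function.ne_iff.1 hv
  obtain ⟨i, -, hi⟩ := Finset.exists_mem_eq_sup Finset.univ ⟨i₀, Finset.mem_univ _⟩
    fun i => ratDeg (v i)
  have hle : ratDeg (v i₀) ≤ ratDeg (v i) :=
    (Finset.le_sup (f := fun i => ratDeg (v i)) (Finset.mem_univ i₀)).trans_eq hi
  have hne : v i ≠ 0 := by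
    intro h0
    rw [h0, ratDeg_of_ne_zero hi₀] at hle
    simp [ratDeg] at hle
  exact ⟨i, hne, hi.trans (ratDeg_of_ne_zero hne)⟩

/-- For a reduced basis `b` with coordinate vectors of degrees `β j`, the `j`-th row of the inverse
of the coordinate matrix has degree at most `-β j`: in Cramer's rule, the column of degree `β j`
is replaced by a constant one, while `det` has degree exactly `∑ k, β k`. -/
theorem ratDeg_repr_le_of_isReduced {a₀ b : Basis ι (RatFunc F) A} (hb : IsReduced a₀ b)
    {β : ι → ℤ} (hβ : ∀ j, vecDeg (fun i => a₀.repr (b j) i) = (β j : WithBot ℤ)) (i j : ι) :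
    ratDeg (b.repr (a₀ i) j) ≤ ((-β j : ℤ) : WithBot ℤ) := by
  set B := a₀.toMatrix b with hB
  have hcol : ∀ i k, ratDeg (B i k) ≤ (β k : WithBot ℤ) := fun i k =>
    (Finset.le_sup (f := fun i => ratDeg (a₀.repr (b k) i)) (Finset.mem_univ i)).trans_eq (hβ k)
  have hinv : b.toMatrix a₀ * B = 1 := b.toMatrix_mul_toMatrix_flip a₀
  have hdet0 : B.det ≠ 0 := by
    intro h
    have := congrArg Matrix.det hinv
    rw [Matrix.det_mul, h, mul_zero, Matrix.det_one] at this
    exact zero_ne_one this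
  have hdet : B.det.intDegree = ∑ k, β k := by
    have h := hb.2
    simp only [hβ] at h
    rw [← hB, ratDeg_of_ne_zero hdet0] at h
    exact_mod_cast h.symm
  -- the `i`-th column of the inverse solves `B *ᵥ y = Pi.single i 1`
  have hcramer : B.det * b.repr (a₀ i) j = (B.updateCol j (Pi.single i 1)).det := by
    have h := congrArg (Matrix.mulVec (b.toMatrix a₀)) (Matrix.mulVec_cramer B (Pi.single i 1))
    rw [Matrix.mulVec_mulVec, hinv, Matrix.one_mulVec, Matrix.mulVec_smul,
      Matrix.mulVec_single_one] at h
    rw [← Matrix.cramer_apply, h]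
    rfl
  have hle : ratDeg (B.det * b.repr (a₀ i) j)
      ≤ ((∑ k, Function.update β j 0 k : ℤ) : WithBot ℤ) := by
    rw [hcramer]
    refine ratDeg_det_le fun i' k => ?_
    by_cases hk : k = j
    · subst hk
      by_cases hi : i' = i
      · subst hi
        simp [ratDeg_le_zero]
      · simp [ratDeg_le_zero, hi]
    · simpa [hk] using hcol i' k
  rw [ratDeg_le_coe] at hle ⊢
  intro hne
  have h := hle (mul_ne_zero hdet0 hne)
  rw [RatFunc.intDegree_mul hdet0 hne, hdet, Finset.sum_update_of_mem (Finset.mem_univ j),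
    ← Finset.add_sum_erase _ _ (Finset.mem_univ j), Finset.sdiff_singleton_eq_erase] at h
  linarith

end Reduced

/-! ### The intersection of the two orders -/

section Main

variable {F : Type*} [Field F] {A : Type*} [Ring A] [Algebra (RatFunc F) A]
  {m ι : Type*} [Fintype m] [DecidableEq m] [Fintype ι] [DecidableEq ι]

/-- A reduced `F[x]`-basis of `Λ` is also an `F(x)`-basis of `A`, with the same coordinates on
`Λ`. -/
theorem exists_basis_of_isReduced {Λ : Subalgebra (polyRing (RatFunc.X : RatFunc F)) A}
    {a₀ : Basis ι (RatFunc F) A} {b : Basis ι (polyRing (RatFunc.X : RatFunc F)) Λ}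
    (hb : IsReduced a₀ fun j => (b j : A)) :
    ∃ b' : Basis ι (RatFunc F) A, (∀ j, b' j = b j) ∧
      ∀ (x : Λ) (j : ι), b'.repr x j = (b.repr x j : RatFunc F) := by
  rcases isEmpty_or_nonempty ι with hι | hι
  · have : Subsingleton A := ⟨fun x y => a₀.repr.injective (Subsingleton.elim _ _)⟩
    exact ⟨a₀, fun j => hι.elim j, fun _ j => hι.elim j⟩
  let b' := basisOfLinearIndependentOfCardEqFinrank hb.1 (finrank_eq_card_basis a₀).symm
  have hb' : ∀ j, b' j = b j := fun j => by simp [b']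
  refine ⟨b', hb', fun x j => ?_⟩
  have hx : (x : A) = ∑ i, (b.repr x i : RatFunc F) • b' i := by
    conv_lhs => rw [← b.sum_repr x]
    rw [AddSubmonoidClass.coe_finsetSum]
    exact Finset.sum_congr rfl fun i _ => by rw [hb']; rfl
  rw [hx, b'.repr_sum_self]

/-- Comparison of an `F[x]`-order and an `F[1/x]`-order: the number `s` is the degree of the quotient of the two scaling
factors `δ(x)` and `δ*(1/x)`. The determinants of the trace form on the two initial lattices
differ in degree by `2 * card ι * s`, whence the numbers `(2 * card ι - 1) * s`. -/
theorem exists_degree_bounds {a a₀ a₁ : Basis ι (RatFunc F) A} {dC : ℕ}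
    (e : A ≃ₐ[RatFunc F] Matrix m m (RatFunc F))
    (ha₀ : IsInitialBasis RatFunc.X dC a a₀) (ha₁ : IsInitialBasis (RatFunc.X)⁻¹ dC a a₁)
    {Λ : Subalgebra (polyRing (RatFunc.X : RatFunc F)) A}
    (hΛ : IsOrder (polyRing (RatFunc.X : RatFunc F)) Λ) (ha₀Λ : ∀ i, a₀ i ∈ Λ)
    {b : Basis ι (RatFunc F) A} (hbΛ : ∀ j, b j ∈ Λ)
    (hbX : ∀ x ∈ Λ, ∀ j, b.repr x j ∈ polyRing (RatFunc.X : RatFunc F))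
    (hb : IsReduced a₀ b)
    {Δ : Subalgebra (polyRing (RatFunc.X : RatFunc F)⁻¹) A}
    (hΔ : IsOrder (polyRing (RatFunc.X : RatFunc F)⁻¹) Δ) (ha₁Δ : ∀ i, a₁ i ∈ Δ) :
    ∃ s : ℤ, 0 ≤ s ∧ s ≤ 2 * Fintype.card ι ^ 3 * dC ∧
      (∀ j, (RatFunc.X : RatFunc F) ^ (-s) • b j ∈ toR Δ) ∧
      (∀ j (k : ℤ), (RatFunc.X : RatFunc F) ^ (-k) • b j ∈ toR Δ →
        -((2 * Fintype.card ι - 1) * s) ≤ k) ∧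
      ∀ x ∈ toR Δ, ∀ j, ratDeg (b.repr x j) ≤ (((2 * Fintype.card ι - 1) * s : ℤ) : WithBot ℤ) := by
  obtain ⟨δ₀, hδ₀, hδ₀d, hδ₀a⟩ := ha₀.exists_smul
  obtain ⟨δ₁, hδ₁, hδ₁d, hδ₁a⟩ := ha₁.exists_smul
  obtain ⟨hu₁, hu₁d, hu₁0⟩ := neg_natDegree_le_intDegree_aeval_inv_X hδ₁
  set u₁ := aeval (RatFunc.X : RatFunc F)⁻¹ δ₁
  have hu₀ : aeval (RatFunc.X : RatFunc F) δ₀ ≠ 0 := by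
    rw [RatFunc.aeval_X_left_eq_algebraMap]
    simpa using hδ₀
  have hu₀d : (aeval (RatFunc.X : RatFunc F) δ₀).intDegree = δ₀.natDegree := by
    rw [RatFunc.aeval_X_left_eq_algebraMap, RatFunc.intDegree_polynomial]
  set u₀ := aeval (RatFunc.X : RatFunc F) δ₀
  have hD := det_traceGram_ne_zero e a
  have hD₀ := det_traceGram_ne_zero e a₀
  have hD₁ := det_traceGram_ne_zero e a₁
  have hdeg₀ := congrArg RatFunc.intDegree (det_traceGram_smul e hδ₀a)
  have hdeg₁ := congrArg RatFunc.intDegree (det_traceGram_smul e hδ₁a)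
  rw [RatFunc.intDegree_mul (pow_ne_zero _ hu₀) hD, intDegree_pow hu₀] at hdeg₀
  rw [RatFunc.intDegree_mul (pow_ne_zero _ hu₁) hD, intDegree_pow hu₁] at hdeg₁
  push_cast at hdeg₀ hdeg₁
  have hcoord : ∀ x i, u₁ * a₁.repr x i = u₀ * a₀.repr x i := fun x i =>
    (repr_eq_mul_repr_of_smul hδ₁a x i).symm.trans (repr_eq_mul_repr_of_smul hδ₀a x i)
  have hcoord0 : ∀ x i, a₁.repr x i ≠ 0 ↔ a₀.repr x i ≠ 0 := fun x i => by
    have h := hcoord x i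
    constructor <;> intro h1 h0 <;> rw [h0, mul_zero] at h
    · exact mul_ne_zero hu₁ h1 h
    · exact mul_ne_zero hu₀ h1 h.symm
  have hcoordDeg : ∀ x i, a₀.repr x i ≠ 0 →
      (a₁.repr x i).intDegree = (a₀.repr x i).intDegree + (u₀.intDegree - u₁.intDegree) := by
    intro x i h0
    have h := congrArg RatFunc.intDegree (hcoord x i)
    rw [RatFunc.intDegree_mul hu₁ ((hcoord0 x i).2 h0), RatFunc.intDegree_mul hu₀ h0] at h
    linarith
  -- the degrees of the coordinates of `RΔ`
  have hRΔ : ∀ x ∈ toR Δ, ∀ i, a₀.repr x i ≠ 0 →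
      (traceGram e a₁).det.intDegree + (a₀.repr x i).intDegree
        + (u₀.intDegree - u₁.intDegree) ≤ 0 := by
    intro x hx i h0
    have h := mem_degLEZero.1 (det_traceGram_mul_repr_mem_degLEZero hΔ e ha₁Δ hx i)
    rw [RatFunc.intDegree_mul hD₁ ((hcoord0 x i).2 h0), hcoordDeg x i h0] at h
    linarith
  have hb0 : ∀ j, (fun i => a₀.repr (b j) i) ≠ 0 := fun j h =>
    b.ne_zero j (a₀.repr.map_eq_zero_iff.1 (Finsupp.ext (congrFun h)))
  choose r hr hβ using fun j => exists_vecDeg_eq (hb0 j)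
  set β : ι → ℤ := fun j => (a₀.repr (b j) (r j)).intDegree
  have hinv := ratDeg_repr_le_of_isReduced hb hβ
  -- the coordinates of `Λ` have the common denominator `det (traceGram e a₀)`
  have hβlow : ∀ j, -(traceGram e a₀).det.intDegree ≤ β j := by
    intro j
    have h := intDegree_nonneg_of_mem_polyRing_X
      (det_traceGram_mul_repr_mem_polyRing hΛ e ha₀Λ (hbΛ j) (r j))
    rw [RatFunc.intDegree_mul hD₀ (hr j)] at h
    linarith
  -- the `b`-coordinates of the vectors `a₀ i` are polynomials of degree at most `-β j`
  have hβup : ∀ j, β j ≤ 0 := by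
    intro j
    obtain ⟨i, hi⟩ : ∃ i, b.repr (a₀ i) j ≠ 0 := by
      by_contra! hcon
      have h := congrFun (congrFun (b.toMatrix_mul_toMatrix_flip a₀) j) j
      rw [Matrix.mul_apply, Matrix.one_apply_eq] at h
      simp [Basis.toMatrix_apply, hcon] at h
    have h1 := ratDeg_le_coe.1 (hinv i j) hi
    have h2 := intDegree_nonneg_of_mem_polyRing_X (hbX _ (ha₀Λ i) j)
    linarith
  refine ⟨u₀.intDegree - u₁.intDegree, by omega, ?_, ?_, ?_, ?_⟩
  · zify at hδ₀d hδ₁d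
    linarith
  · intro j
    refine mem_toR_of_repr_mem ha₁Δ fun i => ?_
    rw [mem_degLEZero, map_smul, Finsupp.smul_apply, smul_eq_mul]
    by_cases h0 : a₀.repr (b j) i = 0
    · rw [not_ne_iff.1 (mt (hcoord0 (b j) i).1 (not_ne_iff.2 h0)), mul_zero, RatFunc.intDegree_zero]
    have hle := (Finset.le_sup (f := fun i => ratDeg (a₀.repr (b j) i))
      (Finset.mem_univ i)).trans_eq (hβ j)
    have hle' := ratDeg_le_coe.1 hle h0
    rw [RatFunc.intDegree_mul (zpow_ne_zero _ RatFunc.X_ne_zero) ((hcoord0 _ _).2 h0),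
      intDegree_X_zpow, hcoordDeg _ _ h0]
    linarith [hβup j]
  · intro j k hk
    have hX : (RatFunc.X : RatFunc F) ^ (-k) ≠ 0 := zpow_ne_zero _ RatFunc.X_ne_zero
    have hrepr : a₀.repr ((RatFunc.X : RatFunc F) ^ (-k) • b j) (r j)
        = RatFunc.X ^ (-k) * a₀.repr (b j) (r j) := by
      rw [map_smul, Finsupp.smul_apply, smul_eq_mul]
    -- the coordinate `r j` of `b j` attains the degree `β j`, and `β j ≥ -deg det (traceGram e a₀)`
    have h := hRΔ _ hk (r j) (by rw [hrepr]; exact mul_ne_zero hX (hr j))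
    rw [hrepr, RatFunc.intDegree_mul hX (hr j), intDegree_X_zpow] at h
    linarith [hβlow j]
  · intro x hx j
    have hsum : b.repr x j = ∑ i, a₀.repr x i * b.repr (a₀ i) j := by
      conv_lhs => rw [← a₀.sum_repr x, map_sum, Finsupp.finsetSum_apply]
      exact Finset.sum_congr rfl fun i _ => by rw [map_smul, Finsupp.smul_apply, smul_eq_mul]
    rw [hsum]
    refine ratDeg_sum_le _ fun i _ => ?_
    have h1 : ratDeg (a₀.repr x i) ≤ ((-(traceGram e a₁).det.intDegree
        - (u₀.intDegree - u₁.intDegree) : ℤ) : WithBot ℤ) :=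
      ratDeg_le_coe.2 fun h0 => by linarith [hRΔ x hx i h0]
    refine (ratDeg_mul_le h1 (hinv i j)).trans (WithBot.coe_le_coe.2 ?_)
    linarith [hβlow j]

omit [DecidableEq ι] in
/-- If the coordinates of the elements of `C = Λ ∩ RΔ` in a basis of `Λ` have degree at most `E`,
then `C` consists of combinations of that basis by polynomials of degree at most `E`. -/
theorem finite_interC_and_finrank_le [Algebra F A] [IsScalarTower F (RatFunc F) A]
    {Λ : Subalgebra (polyRing (RatFunc.X : RatFunc F)) A}
    {Δ : Subalgebra (polyRing (RatFunc.X : RatFunc F)⁻¹) A} {b : Basis ι (RatFunc F) A}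
    (hbX : ∀ x ∈ Λ, ∀ j, b.repr x j ∈ polyRing (RatFunc.X : RatFunc F)) {E : ℕ}
    (hE : ∀ x ∈ toR Δ, ∀ j, ratDeg (b.repr x j) ≤ ((E : ℤ) : WithBot ℤ)) :
    Module.Finite F (interC Λ Δ) ∧ finrank F (interC Λ Δ) ≤ Fintype.card ι * (E + 1) := by
  let φ : (ι → degreeLT F (E + 1)) →ₗ[F] A :=
    ∑ j, ((LinearMap.toSpanSingleton (RatFunc F) A (b j)).restrictScalars F ∘ₗ
      (IsScalarTower.toAlgHom F F[X] (RatFunc F)).toLinearMap ∘ₗ (degreeLT F (E + 1)).subtype) ∘ₗ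
        LinearMap.proj j
  have hle : interC Λ Δ ≤ LinearMap.range φ := by
    rintro x ⟨hxΛ, hxΔ⟩
    choose p hp using fun j => mem_polyRing_X.1 (hbX x hxΛ j)
    refine ⟨fun j => ⟨p j, ?_⟩, ?_⟩
    · rw [mem_degreeLT]
      by_cases h0 : p j = 0
      · rw [h0, degree_zero]
        exact WithBot.bot_lt_coe _
      · have h := hE x hxΔ j
        rw [← hp j, ratDeg_le_coe, RatFunc.intDegree_polynomial] at h
        have h' := h (by simpa using h0)
        rw [degree_eq_natDegree h0]
        exact_mod_cast Nat.lt_succ_of_le (by exact_mod_cast h')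
    · conv_rhs => rw [← b.sum_repr x]
      simp [φ, hp]
  have : Module.Finite F (degreeLT F (E + 1)) :=
    Module.Finite.equiv (degreeLTEquiv F (E + 1)).symm
  have hfin : Module.Finite F (LinearMap.range φ) := inferInstance
  refine ⟨Submodule.finiteDimensional_of_le hle, ?_⟩
  calc finrank F (interC Λ Δ) ≤ finrank F (LinearMap.range φ) := Submodule.finrank_mono hle
    _ ≤ finrank F (ι → degreeLT F (E + 1)) := LinearMap.finrank_range_le φ
    _ = Fintype.card ι * (E + 1) := by
      rw [finrank_pi_fintype, (degreeLTEquiv F (E + 1)).finrank_eq]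
      simp

end Main

end MatrixAlgebraOrders

open MatrixAlgebraOrders in
theorem mainTheorem7
    {F : Type*} [Field F] [Finite F]
    {A : Type*} [Ring A] [Algebra (RatFunc F) A]
    [Algebra F A] [IsScalarTower F (RatFunc F) A]
    (n : ℕ) (hn : 1 ≤ n)
    (hA : Nonempty (A ≃ₐ[RatFunc F] Matrix (Fin n) (Fin n) (RatFunc F)))
    (dC : ℕ) (hdC : 1 ≤ dC)
    (a : Basis (Fin (n ^ 2)) (RatFunc F) A)
    -- the bases of the initial almost orders over `F[x]` and over `F[1/x]`
    (a₀ a₁ : Basis (Fin (n ^ 2)) (RatFunc F) A)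
    (ha₀ : IsInitialBasis RatFunc.X dC a a₀)
    (ha₁ : IsInitialBasis (RatFunc.X)⁻¹ dC a a₁)
    -- the maximal `F[x]`-order and its reduced basis
    (Λ : Subalgebra (polyRing (RatFunc.X : RatFunc F)) A)
    (hΛ : IsMaximalOrder (polyRing (RatFunc.X : RatFunc F)) Λ)
    (ha₀Λ : ∀ i, a₀ i ∈ Λ)
    (b : Basis (Fin (n ^ 2)) (polyRing (RatFunc.X : RatFunc F)) Λ)
    (hb : IsReduced a₀ (fun j => (b j : A)))
    -- the maximal `F[1/x]`-order
    (Δ : Subalgebra (polyRing (RatFunc.X : RatFunc F)⁻¹) A)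
    (hΔ : IsMaximalOrder (polyRing (RatFunc.X : RatFunc F)⁻¹) Δ)
    (ha₁Δ : ∀ i, a₁ i ∈ Δ) :
    (∃ (d : Fin (n ^ 2) → ℤ) (dmax dmin : ℤ),
      (∀ j, IsLeast {m : ℤ | (RatFunc.X : RatFunc F) ^ (-m) • (b j : A) ∈ toR Δ} (d j)) ∧
      IsGreatest (Set.range d) dmax ∧ IsLeast (Set.range d) dmin ∧
      dmax ≤ (2 * (n : ℤ) ^ 8 + 2 * (n : ℤ) ^ 6 + 2 * (n : ℤ) ^ 2) * (dC : ℤ) ∧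
      dmin ≥ -2 * (2 * (n : ℤ) ^ 8 + (n : ℤ) ^ 6 + 2 * (n : ℤ) ^ 2) * (dC : ℤ)) ∧
    Module.Finite F (interC Λ Δ) ∧
    finrank F (interC Λ Δ) ≤
      n ^ 2 * (n ^ 2 * ((2 * n ^ 8 + 2 * n ^ 6 + 2 * n ^ 2) * dC) +
        2 * ((2 * n ^ 8 + n ^ 6 + 2 * n ^ 2) * dC) + 1) := by
  obtain ⟨e⟩ := hA
  obtain ⟨b', hb', hrepr⟩ := exists_basis_of_isReduced hb
  have hbX : ∀ x ∈ Λ, ∀ j, b'.repr x j ∈ polyRing (RatFunc.X : RatFunc F) := fun x hx j => by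
    rw [hrepr ⟨x, hx⟩ j]
    exact (b.repr ⟨x, hx⟩ j).2
  have hred : IsReduced a₀ b' := by
    rwa [show ⇑b' = fun j => (b j : A) from funext hb']
  obtain ⟨s, hs0, hs, hup, hlow, hdeg⟩ := exists_degree_bounds e ha₀ ha₁ hΛ.prop ha₀Λ
    (fun j => (hb' j).symm ▸ (b j).2) hbX hred hΔ.prop ha₁Δ
  rw [Fintype.card_fin] at hs hlow hdeg
  push_cast at hs hlow hdeg
  simp only [hb'] at hup hlow
  have hn0 : (0 : ℤ) ≤ n := Int.natCast_nonneg n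
  have hd0 : (0 : ℤ) ≤ dC := Int.natCast_nonneg dC
  have hn2 : (1 : ℤ) ≤ (n : ℤ) ^ 2 := one_le_pow₀ (by exact_mod_cast hn)
  have hs' : (2 * (n : ℤ) ^ 2 - 1) * s ≤ 4 * (n : ℤ) ^ 8 * dC := by
    calc (2 * (n : ℤ) ^ 2 - 1) * s ≤ 2 * (n : ℤ) ^ 2 * (2 * ((n : ℤ) ^ 2) ^ 3 * dC) :=
          mul_le_mul (by linarith) hs hs0 (by positivity)
      _ = 4 * (n : ℤ) ^ 8 * dC := by ring
  have h2 : 0 ≤ (n : ℤ) ^ 2 * dC := by positivity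
  have h6 : 0 ≤ (n : ℤ) ^ 6 * dC := by positivity
  have h8 : 0 ≤ (n : ℤ) ^ 8 * dC := by positivity
  constructor
  · choose d hd hdmin using fun j => Int.exists_least_of_bdd
      (P := fun k : ℤ => (RatFunc.X : RatFunc F) ^ (-k) • (b j : A) ∈ toR Δ)
      ⟨_, fun k hk => hlow j k hk⟩ ⟨s, hup j⟩
    have : Nonempty (Fin (n ^ 2)) := ⟨⟨0, by positivity⟩⟩
    obtain ⟨jmax, hjmax⟩ := Finite.exists_max d
    obtain ⟨jmin, hjmin⟩ := Finite.exists_min d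
    refine ⟨d, d jmax, d jmin, fun j => ⟨hd j, fun k hk => hdmin j k hk⟩,
      ⟨⟨jmax, rfl⟩, ?_⟩, ⟨⟨jmin, rfl⟩, ?_⟩, ?_, ?_⟩
    · rintro _ ⟨j, rfl⟩
      exact hjmax j
    · rintro _ ⟨j, rfl⟩
      exact hjmin j
    · have h := hdmin jmax s (hup jmax)
      linarith
    · have h := hlow jmin _ (hd jmin)
      linarith
  · obtain ⟨hfin, hrank⟩ := finite_interC_and_finrank_le (E := 4 * n ^ 8 * dC) hbX
      fun x hx j => (hdeg x hx j).trans (WithBot.coe_le_coe.2 (by push_cast; exact hs'))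
    refine ⟨hfin, hrank.trans ?_⟩
    rw [Fintype.card_fin]
    refine Nat.mul_le_mul_left _ (Nat.succ_le_succ (le_add_left ?_))
    calc 4 * n ^ 8 * dC = 2 * (2 * n ^ 8 * dC) := by ring
      _ ≤ 2 * ((2 * n ^ 8 + n ^ 6 + 2 * n ^ 2) * dC) := by gcongr; omega
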